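/- Let $n\ge 1$ and let $\mathbb H^n=\mathbb C^n\times\mathbb R$ be the Heisenberg group with product $(z_1,t_1)\cdot(z_2,t_2)=(z_1+z_2,\,t_1+t_2+2\,\mathrm{Im}(z_1\cdot\overline{z_2}))$, equipped with Lebesgue measure $\mu$ (a bi-invariant Haar measure), and let $Q=2n+2$ be its homogeneous dimension. Writing $z=x+iy$, let $X_j=\partial_{x_j}+2y_j\partial_t$ and $Y_j=\partial_{y_j}-2x_j\partial_t$ ($1\le j\le n$) be the standard left-invariant horizontal vector fields, and let $\nabla_{\mathbb H^n}u=(X_1u,\dots,X_nu,Y_1u,\dots,Y_nu)$ be the subriemannian gradient, understood in the weak sense: $\int u\,X\varphi\,d\mu=-\int (Xu)\,\varphi\,d\mu$ for all $\varphi\in C_c^\infty(\mathbb H^n)$ and each $X\in\{X_j,Y_j\}$, with $u$ and $\nabla_{\mathbb H^n}u$ locally integrable. For $1\le p<\infty$ let $\|f\|_{L^{p,\infty}}=\sup_{s>0}\,s\,\mu(\{|f|>s\})^{1/p}$, and let $L^{p,\infty}(\mathbb H^n)$ be the set of measurable $f$ for which this is finite (for vector-valued $f$, $|f|$ is the Euclidean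 norm). Then there is a constant $C<\infty$, depending only on $n$, such that every real-valued $u\in L^{2,\infty}(\mathbb H^n)$ having weak subriemannian gradient $\nabla_{\mathbb H^n}u\in L^{2,\infty}(\mathbb H^n)$ satisfies $$\|u\|_{L^{\frac{2Q}{Q-2},\infty}}\le C\,\|\nabla_{\mathbb H^n}u\|_{L^{2,\infty}}.$$ In particular the left-hand side is finite. -/

import Mathlib

open MeasureTheory
open scoped ENNReal NNReal

noncomputable section

/-- The Heisenberg group `ℍⁿ`, whose underlying space is `ℂⁿ × ℝ`. A type synonym, so that its group
law does not clash with the componentwise product. -/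
def Heisenberg (n : ℕ) : Type := (Fin n → ℂ) × ℝ

namespace Heisenberg

variable {n : ℕ}

/-! The linear structure, the topology, the smooth structure and the Lebesgue measure of `ℂⁿ × ℝ`
(which is a bi-invariant Haar measure of the group law below). The norm carried by the instance is
only used for the topology and for differentiability. -/

instance : NormedAddCommGroup (Heisenberg n) :=
  inferInstanceAs (NormedAddCommGroup ((Fin n → ℂ) × ℝ))

instance : NormedSpace ℝ (Heisenberg n) :=
  inferInstanceAs (NormedSpace ℝ ((Fin n → ℂ) × ℝ))

instance : MeasureSpace (Heisenberg n) :=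
  inferInstanceAs (MeasureSpace ((Fin n → ℂ) × ℝ))

instance : BorelSpace (Heisenberg n) :=
  inferInstanceAs (BorelSpace ((Fin n → ℂ) × ℝ))

@[ext]
theorem ext {p q : Heisenberg n} (h₁ : ∀ j, p.1 j = q.1 j) (h₂ : p.2 = q.2) : p = q :=
  Prod.ext (funext h₁) h₂

/-- The group law `(z₁, t₁) · (z₂, t₂) = (z₁ + z₂, t₁ + t₂ + 2 Im (z₁ · conj z₂))`. -/
instance : Mul (Heisenberg n) where
  mul p q := (p.1 + q.1, p.2 + q.2 + 2 * (∑ j, p.1 j * starRingEnd ℂ (q.1 j)).im)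

instance : One (Heisenberg n) where
  one := (0, 0)

instance : Inv (Heisenberg n) where
  inv p := (-p.1, -p.2)

theorem mul_fst (p q : Heisenberg n) (j : Fin n) : (p * q).1 j = p.1 j + q.1 j := rfl

theorem mul_snd (p q : Heisenberg n) :
    (p * q).2 = p.2 + q.2 + 2 * (∑ j, p.1 j * starRingEnd ℂ (q.1 j)).im := rfl

theorem one_fst (j : Fin n) : (1 : Heisenberg n).1 j = 0 := rfl

theorem one_snd : (1 : Heisenberg n).2 = 0 := rfl

theorem inv_fst (p : Heisenberg n) (j : Fin n) : (p⁻¹).1 j = -p.1 j := rfl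

theorem inv_snd (p : Heisenberg n) : (p⁻¹).2 = -p.2 := rfl

instance : Group (Heisenberg n) :=
  Group.ofLeftAxioms
    (by
      intro a b c
      ext j
      · simp only [mul_fst, add_assoc]
      · simp only [mul_snd, mul_fst, map_add, add_mul, mul_add, Finset.sum_add_distrib,
          Complex.add_im]
        ring)
    (by
      intro a
      ext j
      · simp only [mul_fst, one_fst, zero_add]
      · simp [mul_snd, one_fst, one_snd])
    (by
      intro a
      ext j
      · simp only [mul_fst, inv_fst, one_fst, neg_add_cancel]
      · simp [mul_snd, inv_fst, inv_snd, one_snd, Complex.mul_conj, -Complex.mul_im])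

/-- The homogeneous dimension `Q = 2n + 2`. -/
def homDim (n : ℕ) : ℕ := 2 * n + 2

/-- The left-invariant horizontal vector fields, with `z = x + i y`:
`Sum.inl j` gives `X_j = ∂/∂x_j + 2 y_j ∂/∂t` and `Sum.inr j` gives `Y_j = ∂/∂y_j - 2 x_j ∂/∂t`. -/
def horizontalField : Fin n ⊕ Fin n → Heisenberg n → Heisenberg n
  | Sum.inl j, p => (Pi.single j 1, 2 * (p.1 j).im)
  | Sum.inr j, p => (Pi.single j Complex.I, -2 * (p.1 j).re)

/-- `g = (X_1 u, …, X_n u, Y_1 u, …, Y_n u)` is the weak subriemannian gradient of `u`: both are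
locally integrable and `∫ u X φ = - ∫ (X u) φ` for every test function `φ ∈ C_c^∞(ℍⁿ)` and each of
the (divergence-free) fields `X = X_j, Y_j`. -/
structure IsWeakGradient (u : Heisenberg n → ℝ)
    (g : Heisenberg n → EuclideanSpace ℝ (Fin n ⊕ Fin n)) : Prop where
  locallyIntegrable : LocallyIntegrable u volume
  locallyIntegrable_gradient : LocallyIntegrable g volume
  integral_eq : ∀ (i : Fin n ⊕ Fin n) (φ : Heisenberg n → ℝ),
    ContDiff ℝ (⊤ : ℕ∞) φ → HasCompactSupport φ →
      ∫ p, u p * fderiv ℝ φ p (horizontalField i p) = -∫ p, g p i * φ p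

end Heisenberg

/-- The quasinorm of the Lorentz space `L^{p,∞}` (weak `L^p`), for `0 < p < ∞`:
`sup_{s > 0} s μ{|f| > s}^{1/p}`, an extended nonnegative real. -/
def weakLpNorm {X E : Type*} [MeasurableSpace X] [NormedAddCommGroup E]
    (f : X → E) (p : ℝ) (μ : Measure X) : ℝ≥0∞ :=
  ⨆ (s : ℝ≥0) (_ : 0 < s), (s : ℝ≥0∞) * μ {x | s < ‖f x‖₊} ^ (1 / p)

/-- `f ∈ L^{p,∞}`. -/
def MemWeakLp {X E : Type*} [MeasurableSpace X] [NormedAddCommGroup E]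
    (f : X → E) (p : ℝ) (μ : Measure X) : Prop :=
  AEStronglyMeasurable f μ ∧ weakLpNorm f p μ < ∞

end

/-! The proof is a real-variable argument: approximate `u` by its averages `A_r u` over
left-translated boxes of radius `r`, and optimise `r` at each level `s`. Write `G` for the size of
the gradient in `L^{2,∞}`, measured by `SqrtBound`, which unlike the quasinorm passes under sums and
averages without loss of constants.

Translations: along a horizontal line the fundamental theorem of calculus writes `u(p · exp z) -
u(p)` as an average of directional derivatives, so it has size `≲ ‖z‖ G`. A vertical step of height
`t` is a commutator of horizontal steps of length `√|t|/2`. Hence right translation by any element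
of the box of radius `r` costs `≲ r G` (`sqrtBound_sub_translate`), and so does `u - A_r u`
(`sqrtBound_sub_boxAverage`).

Averages: a box has measure `(κ r^{n+1})²`, so averaging turns a `SqrtBound` of `N` into a sup bound
of `N / (κ r^{n+1})`. Applied to `u - A_{2r} u` and iterated over dyadic radii, this gives a
geometric series and `|A_r u| ≲ G / r^n`; the remainder vanishes because `u` itself lies in
`L^{2,∞}` (`IsWeakGradient.nnnorm_boxAverage_le`).

Level sets: with `r^n ≈ G / s` the average is at most `s/2`, so `|u - A_r u| ≥ s/2` on `{|u| > s}`,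
whence `s μ{|u| > s}^{1/2} ≲ r G`. Eliminating `r` gives the exponent `n / (2(n+1)) = (Q-2) / (2Q)`.
-/

noncomputable section

namespace Heisenberg

variable {n : ℕ}

/-! ### Topology, invariance of Lebesgue measure, and homogeneous boxes. -/

instance : SecondCountableTopology (Heisenberg n) :=
  inferInstanceAs (SecondCountableTopology ((Fin n → ℂ) × ℝ))

instance : FiniteDimensional ℝ (Heisenberg n) :=
  inferInstanceAs (FiniteDimensional ℝ ((Fin n → ℂ) × ℝ))

instance : SFinite (volume : Measure (Heisenberg n)) :=
  inferInstanceAs (SFinite (volume : Measure ((Fin n → ℂ) × ℝ)))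

instance : IsLocallyFiniteMeasure (volume : Measure (Heisenberg n)) :=
  inferInstanceAs (IsLocallyFiniteMeasure (volume : Measure ((Fin n → ℂ) × ℝ)))

theorem continuous_fst : Continuous (fun p : Heisenberg n => p.1) :=
  _root_.continuous_fst (X := Fin n → ℂ) (Y := ℝ)

theorem continuous_snd : Continuous (fun p : Heisenberg n => p.2) :=
  _root_.continuous_snd (X := Fin n → ℂ) (Y := ℝ)

/-- The point of `ℍⁿ` with the coordinates `z` and `t`. -/
def mk (z : Fin n → ℂ) (t : ℝ) : Heisenberg n := (z, t)

theorem continuous_mk {X : Type*} [TopologicalSpace X] {f : X → Fin n → ℂ} {g : X → ℝ}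
    (hf : Continuous f) (hg : Continuous g) :
    Continuous (fun x => mk (f x) (g x)) :=
  Continuous.prodMk hf hg

instance : ContinuousMul (Heisenberg n) where
  continuous_mul := by
    have h1 : Continuous fun x : Heisenberg n × Heisenberg n => x.1.1 :=
      continuous_fst.comp _root_.continuous_fst
    have h2 : Continuous fun x : Heisenberg n × Heisenberg n => x.2.1 :=
      continuous_fst.comp _root_.continuous_snd
    have h3 : Continuous fun x : Heisenberg n × Heisenberg n => x.1.2 :=
      continuous_snd.comp _root_.continuous_fst
    have h4 : Continuous fun x : Heisenberg n × Heisenberg n => x.2.2 :=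
      continuous_snd.comp _root_.continuous_snd
    refine continuous_mk (h1.add h2) ((h3.add h4).add (continuous_const.mul ?_))
    refine Complex.continuous_im.comp (continuous_finsetSum _ fun j _ => ?_)
    exact ((continuous_apply j).comp h1).mul
      (Complex.continuous_conj.comp ((continuous_apply j).comp h2))

/-- A shear of `ℂⁿ × ℝ` composed with a translation preserves Lebesgue measure. -/
theorem measurePreserving_shear (a : Fin n → ℂ) {f : (Fin n → ℂ) → ℝ} (hf : Continuous f) :
    MeasurePreserving (fun p : Heisenberg n => mk (a + p.1) (f p.1 + p.2)) := by
  have h : MeasurePreserving (fun p : (Fin n → ℂ) × ℝ => (a + p.1, f p.1 + p.2))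
      (volume.prod volume) (volume.prod volume) := by
    refine (measurePreserving_add_left volume a).skew_product (g := fun z t => f z + t) ?_ ?_
    · exact ((hf.comp _root_.continuous_fst).add _root_.continuous_snd).measurable
    · exact Filter.Eventually.of_forall fun z => (measurePreserving_add_left volume (f z)).map_eq
  exact h

theorem measurePreserving_mul_left' (q : Heisenberg n) :
    MeasurePreserving (fun p : Heisenberg n => q * p) := by
  have hf : Continuous fun z : Fin n → ℂ =>
      q.2 + 2 * (∑ j, q.1 j * starRingEnd ℂ (z j)).im := by
    refine continuous_const.add (continuous_const.mul (Complex.continuous_im.comp ?_))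
    exact continuous_finsetSum _ fun j _ => continuous_const.mul
      (Complex.continuous_conj.comp (continuous_apply j))
  refine (funext fun p => Heisenberg.ext (fun j => rfl) ?_ :
    (fun p => mk (q.1 + p.1) (q.2 + 2 * (∑ j, q.1 j * starRingEnd ℂ (p.1 j)).im + p.2)) =
      fun p : Heisenberg n => q * p) ▸ measurePreserving_shear q.1 hf
  simp only [mul_snd, mk]; ring

theorem measurePreserving_mul_right' (q : Heisenberg n) :
    MeasurePreserving (fun p : Heisenberg n => p * q) := by
  have hf : Continuous fun z : Fin n → ℂ =>
      q.2 + 2 * (∑ j, z j * starRingEnd ℂ (q.1 j)).im := by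
    refine continuous_const.add (continuous_const.mul (Complex.continuous_im.comp ?_))
    exact continuous_finsetSum _ fun j _ => (continuous_apply j).mul continuous_const
  refine (funext fun p => Heisenberg.ext (fun j => add_comm _ _) ?_ :
    (fun p => mk (q.1 + p.1) (q.2 + 2 * (∑ j, p.1 j * starRingEnd ℂ (q.1 j)).im + p.2)) =
      fun p : Heisenberg n => p * q) ▸ measurePreserving_shear q.1 hf
  simp only [mul_snd, mk]; ring

instance : (volume : Measure (Heisenberg n)).IsMulLeftInvariant :=
  ⟨fun q => (measurePreserving_mul_left' q).map_eq⟩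

instance : (volume : Measure (Heisenberg n)).IsMulRightInvariant :=
  ⟨fun q => (measurePreserving_mul_right' q).map_eq⟩

/-- The box `{(z, t) : |z| ≤ r, |t| ≤ r²}`, with `|z|` the maximum of the `|z_j|`. -/
def box (n : ℕ) (r : ℝ) : Set (Heisenberg n) := {p | ‖p.1‖ ≤ r ∧ |p.2| ≤ r ^ 2}

theorem measurableSet_box (r : ℝ) : MeasurableSet (box n r) :=
  ((isClosed_le continuous_fst.norm continuous_const).inter
    (isClosed_le continuous_snd.abs continuous_const)).measurableSet

/-- The volume scales like `r^Q` with `Q = 2(n+1)`; it is recorded as a square because `SqrtBound`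
always uses its square root. -/
theorem exists_volume_box (n : ℕ) : ∃ κ : ℝ≥0, 0 < κ ∧ ∀ r : ℝ≥0,
    volume (box n r) = ((κ * r ^ (n + 1) : ℝ≥0) : ℝ≥0∞) ^ 2 := by
  set c : ℝ≥0∞ := volume (Metric.closedBall (0 : Fin n → ℂ) 1)
  have hc0 : 0 < c := Metric.measure_closedBall_pos _ _ one_pos
  have hct : c ≠ ∞ := measure_closedBall_lt_top.ne
  refine ⟨NNReal.sqrt (2 * c.toNNReal), ?_, fun r => ?_⟩
  · have : 0 < c.toNNReal := ENNReal.toNNReal_pos hc0.ne' hct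
    positivity
  · have h1 : (box n r) = (Metric.closedBall (0 : Fin n → ℂ) r ×ˢ
        Metric.closedBall (0 : ℝ) ((r : ℝ) ^ 2) : Set ((Fin n → ℂ) × ℝ)) := by
      ext p
      exact and_congr mem_closedBall_zero_iff.symm
        (by rw [mem_closedBall_zero_iff, Real.norm_eq_abs])
    have h2 : volume (box n r) = volume (Metric.closedBall (0 : Fin n → ℂ) r) *
        volume (Metric.closedBall (0 : ℝ) ((r : ℝ) ^ 2)) := by
      rw [h1]
      exact Measure.prod_prod _ _
    rw [h2, Measure.addHaar_closedBall' _ _ r.coe_nonneg, Real.volume_closedBall]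
    have h3 : Module.finrank ℝ (Fin n → ℂ) = 2 * n := by
      rw [Module.finrank_pi_fintype]; simp [Complex.finrank_real_complex, mul_comm]
    rw [h3]
    have h4 : ENNReal.ofReal ((r : ℝ) ^ (2 * n)) = ((r ^ (2 * n) : ℝ≥0) : ℝ≥0∞) := by
      rw [← ENNReal.ofReal_coe_nnreal]; simp
    have h5 : ENNReal.ofReal (2 * (r : ℝ) ^ 2) = ((2 * r ^ 2 : ℝ≥0) : ℝ≥0∞) := by
      rw [← ENNReal.ofReal_coe_nnreal]; simp
    change _ * c * _ = _
    rw [h4, h5, ← ENNReal.coe_toNNReal hct]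
    norm_cast
    rw [mul_pow, NNReal.sq_sqrt]
    ring

end Heisenberg
end

/-! ### Weak `L²` through integrals over sets. -/

noncomputable section

/-- The averages of `|f|` over sets satisfy `∫_s |f| ≤ N μ(s)^{1/2}`; the least such `N` is a norm
equivalent to the quasinorm of `L^{2,∞}`. -/
def SqrtBound {X E : Type*} [MeasurableSpace X] [NormedAddCommGroup E]
    (f : X → E) (N : ℝ≥0) (μ : Measure X) : Prop :=
  ∀ s, MeasurableSet s → ∫⁻ x in s, ‖f x‖ₑ ∂μ ≤ N * μ s ^ (1 / 2 : ℝ)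

section WeakLp

variable {X E : Type*} [MeasurableSpace X] [NormedAddCommGroup E] {f : X → E} {μ : Measure X}

theorem weakLpNorm_congr_ae {f' : X → E} (h : f =ᵐ[μ] f') (p : ℝ) :
    weakLpNorm f p μ = weakLpNorm f' p μ := by
  unfold weakLpNorm
  refine iSup_congr fun s => iSup_congr fun _ => ?_
  congr 2
  refine measure_congr ?_
  filter_upwards [h] with x hx
  exact congrArg (fun y : E => s < ‖y‖₊) hx

theorem measure_lt_nnnorm_le {W : ℝ≥0} (hW : weakLpNorm f 2 μ ≤ W) {s : ℝ≥0} (hs : 0 < s) :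
    μ {x | s < ‖f x‖₊} ≤ ((W / s) ^ 2 : ℝ≥0) := by
  have h1 : (s : ℝ≥0∞) * μ {x | s < ‖f x‖₊} ^ (1 / 2 : ℝ) ≤ W :=
    le_trans (le_iSup₂ (f := fun (s : ℝ≥0) (_ : 0 < s) =>
      (s : ℝ≥0∞) * μ {x | s < ‖f x‖₊} ^ (1 / 2 : ℝ)) s hs) hW
  have hs' : (s : ℝ≥0∞) ≠ 0 := by simpa using hs.ne'
  have h2 : μ {x | s < ‖f x‖₊} ^ (1 / 2 : ℝ) ≤ (W / s : ℝ≥0) := by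
    rw [ENNReal.coe_div hs.ne', ENNReal.le_div_iff_mul_le (Or.inl hs') (Or.inl ENNReal.coe_ne_top),
      mul_comm]
    exact h1
  calc μ {x | s < ‖f x‖₊} = (μ {x | s < ‖f x‖₊} ^ (1 / 2 : ℝ)) ^ 2 := by
        rw [← ENNReal.rpow_natCast, ← ENNReal.rpow_mul]; norm_num
    _ ≤ ((W / s : ℝ≥0) : ℝ≥0∞) ^ 2 := by gcongr
    _ = _ := by norm_cast

theorem lintegral_Ioi_inv_sq (W : ℝ≥0) {l : ℝ≥0} (hl : 0 < l) :
    ∫⁻ t in Set.Ioi (l : ℝ), ENNReal.ofReal ((W / t) ^ 2) = (W ^ 2 / l : ℝ≥0) := by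
  have h0 : (0 : ℝ) < l := hl
  have hi : IntegrableOn (fun t : ℝ => (W : ℝ) ^ 2 * t ^ (-2 : ℝ)) (Set.Ioi (l : ℝ)) :=
    (integrableOn_Ioi_rpow_of_lt (by norm_num) h0).const_mul _
  have heq : ∀ t ∈ Set.Ioi (l : ℝ), ENNReal.ofReal ((W / t) ^ 2) =
      ENNReal.ofReal ((W : ℝ) ^ 2 * t ^ (-2 : ℝ)) := by
    intro t ht
    have : (0 : ℝ) < t := h0.trans ht
    rw [Real.rpow_neg this.le, div_pow]
    norm_num [div_eq_mul_inv]
  rw [setLIntegral_congr_fun measurableSet_Ioi heq, ← ofReal_integral_eq_lintegral_ofReal hi,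
    integral_const_mul, integral_Ioi_rpow_of_lt (by norm_num) h0, ← ENNReal.ofReal_coe_nnreal]
  · congr 1
    norm_num [Real.rpow_neg_one]
    rfl
  · refine (ae_restrict_iff' measurableSet_Ioi).2 (Filter.Eventually.of_forall fun t ht => ?_)
    have : (0 : ℝ) < t := h0.trans ht
    positivity

/-- Layer-cake formula on `s`: the distribution function at height `t` is at most `μ s` and at most
`(W / t)²`; low heights use the first bound, high ones the second. -/
theorem sqrtBound_of_weakLpNorm_le (hf : AEStronglyMeasurable f μ) {W : ℝ≥0} (hW0 : 0 < W)
    (hW : weakLpNorm f 2 μ ≤ W) : SqrtBound f (2 * W) μ := by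
  intro s hs
  rcases eq_or_ne (μ s) 0 with h0 | h0
  · rw [Measure.restrict_eq_zero.2 h0]; simp
  rcases eq_or_ne (μ s) ∞ with ht | ht
  · rw [ht, ENNReal.top_rpow_of_pos (by norm_num), ENNReal.mul_top (by simpa using hW0.ne')]
    exact le_top
  set x : ℝ≥0 := NNReal.sqrt (μ s).toNNReal with hx
  have hxpos : 0 < x := by
    have := ENNReal.toNNReal_pos h0 ht
    positivity
  have hxs : μ s = ((x ^ 2 : ℝ≥0) : ℝ≥0∞) := by
    rw [hx, NNReal.sq_sqrt, ENNReal.coe_toNNReal ht]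
  have hxr : μ s ^ (1 / 2 : ℝ) = x := by
    rw [hxs, ENNReal.coe_pow, ← ENNReal.rpow_natCast, ← ENNReal.rpow_mul]; norm_num
  -- The height at which the two bounds agree; each range then contributes `W x`, whence the factor
  -- 2.
  set l : ℝ≥0 := W / x with hl
  have hlpos : 0 < l := by positivity
  calc ∫⁻ x in s, ‖f x‖ₑ ∂μ = ∫⁻ x in s, ENNReal.ofReal ‖f x‖ ∂μ := by
        simp_rw [ofReal_norm]
    _ = ∫⁻ t in Set.Ioi (0 : ℝ), μ.restrict s {a | t < ‖f a‖} :=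
        lintegral_eq_lintegral_meas_lt _ (Filter.Eventually.of_forall fun _ => norm_nonneg _)
          hf.norm.aemeasurable.restrict
    _ ≤ (∫⁻ t in Set.Ioc (0 : ℝ) l, μ.restrict s {a | t < ‖f a‖}) +
          ∫⁻ t in Set.Ioi (l : ℝ), μ.restrict s {a | t < ‖f a‖} := by
        rw [← Set.Ioc_union_Ioi_eq_Ioi l.coe_nonneg]
        exact lintegral_union_le _ _ _
    _ ≤ (∫⁻ _ in Set.Ioc (0 : ℝ) l, μ s) +
          ∫⁻ t in Set.Ioi (l : ℝ), ENNReal.ofReal ((W / t) ^ 2) := by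
        refine add_le_add (lintegral_mono fun t => ?_) (setLIntegral_mono' measurableSet_Ioi ?_)
        · exact (measure_mono (Set.subset_univ _)).trans_eq (Measure.restrict_apply_univ s)
        · intro t ht
          have ht0 : (0 : ℝ) < t := lt_trans hlpos ht
          lift t to ℝ≥0 using ht0.le
          refine (Measure.restrict_apply_le _ _).trans
            ((measure_lt_nnnorm_le hW (NNReal.coe_pos.1 ht0)).trans_eq ?_)
          rw [← ENNReal.ofReal_coe_nnreal]
          rfl
    _ = l * ((x ^ 2 : ℝ≥0) : ℝ≥0∞) + (W ^ 2 / l : ℝ≥0) := by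
        rw [lintegral_Ioi_inv_sq W hlpos, setLIntegral_const, Real.volume_Ioc, hxs, sub_zero,
          ENNReal.ofReal_coe_nnreal, mul_comm]
    _ = ((2 * W : ℝ≥0) : ℝ≥0∞) * μ s ^ (1 / 2 : ℝ) := by
        rw [hxr]
        norm_cast
        rw [hl]
        field_simp
        ring

theorem SqrtBound.congr_ae {N : ℝ≥0} {f' : X → E} (hf : SqrtBound f N μ) (h : f =ᵐ[μ] f') :
    SqrtBound f' N μ := fun s hs =>
  (lintegral_congr_ae (ae_restrict_of_ae (h.mono fun x hx => by
    simp only [hx]))).trans_le (hf s hs)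

theorem SqrtBound.mono {N N' : ℝ≥0} {F : Type*} [NormedAddCommGroup F] {f' : X → F}
    (hf : SqrtBound f N μ) (h : ∀ᵐ x ∂μ, ‖f' x‖ₑ ≤ ‖f x‖ₑ) (hN : N ≤ N') : SqrtBound f' N' μ :=
  fun s hs => (lintegral_mono_ae (ae_restrict_of_ae h)).trans
    ((hf s hs).trans (mul_le_mul_left (ENNReal.coe_le_coe.2 hN) _))

theorem SqrtBound.add {N N' : ℝ≥0} {f' : X → E} (hf : SqrtBound f N μ) (hf' : SqrtBound f' N' μ)
    (hm : AEStronglyMeasurable f μ) : SqrtBound (f + f') (N + N') μ := by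
  intro s hs
  calc ∫⁻ x in s, ‖(f + f') x‖ₑ ∂μ ≤ ∫⁻ x in s, (‖f x‖ₑ + ‖f' x‖ₑ) ∂μ :=
        lintegral_mono fun x => enorm_add_le _ _
    _ = (∫⁻ x in s, ‖f x‖ₑ ∂μ) + ∫⁻ x in s, ‖f' x‖ₑ ∂μ :=
        lintegral_add_left' hm.enorm.restrict _
    _ ≤ _ := (add_le_add (hf s hs) (hf' s hs)).trans_eq (by rw [ENNReal.coe_add, add_mul])

theorem SqrtBound.comp_measurePreserving {N : ℝ≥0} (hf : SqrtBound f N μ)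
    {T : X ≃ᵐ X} (hT : MeasurePreserving T μ μ) : SqrtBound (f ∘ T) N μ := by
  intro s hs
  have h1 : s = T ⁻¹' (T.symm ⁻¹' s) := by ext; simp
  have h2 : MeasurableSet (T.symm ⁻¹' s) := T.symm.measurable hs
  have h3 := hT.setLIntegral_comp_preimage_emb T.measurableEmbedding (fun x => ‖f x‖ₑ)
    (T.symm ⁻¹' s)
  rw [← h1] at h3
  calc _ = _ := h3
    _ ≤ _ := hf _ h2
    _ = _ := by
      rw [← hT.measure_preimage h2.nullMeasurableSet, ← h1]

theorem SqrtBound.locallyIntegrable [TopologicalSpace X] [IsLocallyFiniteMeasure μ]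
    [OpensMeasurableSpace X] {N : ℝ≥0} (hf : SqrtBound f N μ) (hm : AEStronglyMeasurable f μ) :
    LocallyIntegrable f μ := by
  intro x
  obtain ⟨t, hxt, hto, ht⟩ := Measure.exists_isOpen_measure_lt_top μ x
  refine ⟨t, hto.mem_nhds hxt, hm.restrict, (hf t hto.measurableSet).trans_lt ?_⟩
  exact ENNReal.mul_lt_top ENNReal.coe_lt_top (ENNReal.rpow_lt_top_of_nonneg (by norm_num) ht.ne)

/-- Minkowski's inequality for averages, by Tonelli. -/
theorem SqrtBound.integral {T : Type*} [MeasurableSpace T] {ν : Measure T}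
    [IsProbabilityMeasure ν] [SFinite μ] [NormedSpace ℝ E] {F : X → T → E} {N : ℝ≥0}
    (hF : StronglyMeasurable (Function.uncurry F)) (hb : ∀ᵐ t ∂ν, SqrtBound (F · t) N μ) :
    SqrtBound (fun x => ∫ t, F x t ∂ν) N μ := by
  intro s hs
  calc ∫⁻ x in s, ‖∫ t, F x t ∂ν‖ₑ ∂μ ≤ ∫⁻ x in s, ∫⁻ t, ‖F x t‖ₑ ∂ν ∂μ :=
        lintegral_mono fun x => enorm_integral_le_lintegral_enorm _
    _ = ∫⁻ t, ∫⁻ x in s, ‖F x t‖ₑ ∂μ ∂ν := lintegral_lintegral_swap hF.enorm.aemeasurable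
    _ ≤ ∫⁻ _, N * μ s ^ (1 / 2 : ℝ) ∂ν := lintegral_mono_ae (hb.mono fun t ht => ht s hs)
    _ = _ := by simp

end WeakLp
end

/-! ### Horizontal directions and their one-parameter subgroups. -/

noncomputable section

namespace Heisenberg

variable {n : ℕ}

/-- The coordinates of a horizontal vector `z ∈ ℂⁿ` in the frame `X_j, Y_j`. -/
def frameCoord (z : Fin n → ℂ) : Fin n ⊕ Fin n → ℝ :=
  Sum.elim (fun j => (z j).re) fun j => (z j).im

/-- The left-invariant horizontal field `∑ x_j X_j + y_j Y_j`, where `z = x + i y`. -/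
def leftField (z : Fin n → ℂ) (p : Heisenberg n) : Heisenberg n :=
  mk z (2 * (∑ j, p.1 j * starRingEnd ℂ (z j)).im)

theorem fst_sum {ι : Type*} (s : Finset ι) (f : ι → Heisenberg n) :
    (∑ i ∈ s, f i).1 = ∑ i ∈ s, (f i).1 :=
  Prod.fst_sum (M := Fin n → ℂ) (N := ℝ)

theorem snd_sum {ι : Type*} (s : Finset ι) (f : ι → Heisenberg n) :
    (∑ i ∈ s, f i).2 = ∑ i ∈ s, (f i).2 :=
  Prod.snd_sum (M := Fin n → ℂ) (N := ℝ)

theorem smul_fst (c : ℝ) (p : Heisenberg n) (j : Fin n) : (c • p).1 j = c * p.1 j :=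
  Complex.real_smul

theorem smul_snd (c : ℝ) (p : Heisenberg n) : (c • p).2 = c * p.2 := rfl

theorem add_fst (p q : Heisenberg n) (j : Fin n) : (p + q).1 j = p.1 j + q.1 j := rfl

theorem add_snd (p q : Heisenberg n) : (p + q).2 = p.2 + q.2 := rfl

theorem leftField_eq_sum (z : Fin n → ℂ) (p : Heisenberg n) :
    leftField z p = ∑ i, frameCoord z i • horizontalField i p := by
  refine Heisenberg.ext (fun j => ?_) ?_
  · rw [fst_sum, Finset.sum_apply, Fintype.sum_sum_type]
    simp_rw [smul_fst]
    simp only [leftField, mk, frameCoord, horizontalField, Sum.elim_inl, Sum.elim_inr,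
      Pi.single_apply, mul_ite, mul_one, mul_zero, Finset.sum_ite_eq, Finset.mem_univ, if_true]
    exact (Complex.re_add_im _).symm
  · rw [snd_sum, Fintype.sum_sum_type, ← Finset.sum_add_distrib]
    simp_rw [smul_snd]
    simp only [leftField, mk, frameCoord, horizontalField, Sum.elim_inl, Sum.elim_inr,
      Complex.im_sum, Finset.mul_sum, Complex.mul_im, Complex.conj_re, Complex.conj_im]
    refine Finset.sum_congr rfl fun j _ => ?_
    ring

/-- The one-parameter subgroup of the horizontal direction `z`. -/
def horizontal (z : Fin n → ℂ) (τ : ℝ) : Heisenberg n := mk (τ • z) 0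

/-- The group law is affine in its second factor, so the integral curves of a left-invariant
horizontal field are straight lines. -/
theorem mul_horizontal (p : Heisenberg n) (z : Fin n → ℂ) (τ : ℝ) :
    p * horizontal z τ = p + τ • leftField z p := by
  refine Heisenberg.ext (fun j => ?_) ?_
  · rw [mul_fst, add_fst, smul_fst]
    simp only [horizontal, leftField, mk, Pi.smul_apply, Complex.real_smul]
  · rw [mul_snd, add_snd, smul_snd]
    simp only [horizontal, leftField, mk, Pi.smul_apply, Complex.real_smul, map_mul,
      Complex.conj_ofReal, add_zero, Complex.im_sum, Finset.mul_sum]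
    congr 1
    refine Finset.sum_congr rfl fun j _ => ?_
    simp only [Complex.mul_im, Complex.mul_re, Complex.ofReal_re, Complex.ofReal_im]
    ring

theorem horizontal_add (z : Fin n → ℂ) (s t : ℝ) :
    horizontal z s * horizontal z t = horizontal z (s + t) := by
  refine Heisenberg.ext (fun j => ?_) ?_
  · rw [mul_fst]
    simp [horizontal, mk, add_mul]
  · rw [mul_snd]
    simp only [horizontal, mk, Pi.smul_apply, Complex.real_smul, map_mul, Complex.conj_ofReal,
      add_zero, zero_add, mul_eq_zero, Complex.im_sum]
    right
    refine Finset.sum_eq_zero fun j _ => ?_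
    simp only [Complex.mul_im, Complex.mul_re, Complex.ofReal_re, Complex.ofReal_im,
      Complex.conj_re, Complex.conj_im]
    ring

theorem horizontal_zero (z : Fin n → ℂ) : horizontal z 0 = 1 :=
  Heisenberg.ext (fun j => by simp [horizontal, mk, one_fst]) rfl

theorem continuous_horizontal (z : Fin n → ℂ) : Continuous (horizontal z) :=
  continuous_mk (continuous_id.smul continuous_const) continuous_const

theorem continuous_leftField (z : Fin n → ℂ) : Continuous (leftField z) := by
  refine continuous_mk continuous_const (continuous_const.mul (Complex.continuous_im.comp ?_))
  exact continuous_finsetSum _ fun j _ =>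
    ((continuous_apply j).comp continuous_fst).mul continuous_const

theorem contDiff_leftField (z : Fin n → ℂ) : ContDiff ℝ (⊤ : ℕ∞) (leftField z) := by
  have h1 : ContDiff ℝ (⊤ : ℕ∞) fun p : Heisenberg n => p.1 :=
    _root_.contDiff_fst (E := Fin n → ℂ) (F := ℝ)
  have h2 : ContDiff ℝ (⊤ : ℕ∞) fun p : Heisenberg n =>
      2 * (∑ j, p.1 j * starRingEnd ℂ (z j)).im := by
    refine contDiff_const.mul (Complex.imCLM.contDiff.comp ?_)
    exact ContDiff.sum fun j _ => (contDiff_pi.1 h1 j).mul contDiff_const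
  exact ContDiff.prodMk (contDiff_const (c := z)) h2

theorem contDiff_mul_horizontal (z : Fin n → ℂ) (τ : ℝ) :
    ContDiff ℝ (⊤ : ℕ∞) fun p : Heisenberg n => p * horizontal z τ := by
  simp_rw [mul_horizontal]
  exact contDiff_id.add ((contDiff_leftField z).const_smul τ)

/-! ### Calculus along horizontal lines. -/

theorem hasDerivAt_comp_mul_horizontal {φ : Heisenberg n → ℝ} (hφ : ContDiff ℝ (⊤ : ℕ∞) φ)
    (p : Heisenberg n) (z : Fin n → ℂ) (τ : ℝ) :
    HasDerivAt (fun s => φ (p * horizontal z s))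
      (fderiv ℝ φ (p * horizontal z τ) (leftField z p)) τ := by
  have h1 : HasDerivAt (fun s : ℝ => p * horizontal z s) (leftField z p) τ := by
    simp_rw [mul_horizontal]
    simpa using ((hasDerivAt_id τ).smul_const (leftField z p)).const_add p
  exact ((hφ.differentiable (by simp)) _).hasFDerivAt.comp_hasDerivAt τ h1

/-- A field commutes with its own flow: both sides are the derivative at `s = 0` of `φ (p *
horizontal z (s + τ))`. Right translations in other directions need not commute with it. -/
theorem fderiv_comp_mul_horizontal {φ : Heisenberg n → ℝ} (hφ : ContDiff ℝ (⊤ : ℕ∞) φ)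
    (p : Heisenberg n) (z : Fin n → ℂ) (τ : ℝ) :
    fderiv ℝ (fun p => φ (p * horizontal z τ)) p (leftField z p) =
      fderiv ℝ φ (p * horizontal z τ) (leftField z p) := by
  have h1 := hasDerivAt_comp_mul_horizontal (hφ.comp (contDiff_mul_horizontal z τ)) p z 0
  simp only [horizontal_zero, mul_one, Function.comp_def, mul_assoc, horizontal_add] at h1
  have h2 := hasDerivAt_comp_mul_horizontal hφ p z (0 + τ)
  have h3 := h2.comp_add_const 0 τ
  rw [zero_add] at h3
  exact h1.unique h3

theorem hasCompactSupport_comp_mul_right {φ : Heisenberg n → ℝ} (hφ : HasCompactSupport φ)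
    (q : Heisenberg n) : HasCompactSupport fun p => φ (p * q) :=
  hφ.comp_homeomorph (Homeomorph.mulRight q)

/-- The derivative in the direction `z` of a function with the gradient `v`. -/
def dirDeriv (z : Fin n → ℂ) (v : EuclideanSpace ℝ (Fin n ⊕ Fin n)) : ℝ :=
  ∑ i, frameCoord z i * v i

theorem continuous_dirDeriv (z : Fin n → ℂ) : Continuous (dirDeriv z) := by
  unfold dirDeriv
  fun_prop

theorem abs_dirDeriv_le (z : Fin n → ℂ) (v : EuclideanSpace ℝ (Fin n ⊕ Fin n)) :
    |dirDeriv z v| ≤ 2 * n * ‖z‖ * ‖v‖ := by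
  have h : ∀ i, |frameCoord z i| ≤ ‖z‖ := by
    rintro (j | j)
    · exact (Complex.abs_re_le_norm _).trans (norm_le_pi_norm z j)
    · exact (Complex.abs_im_le_norm _).trans (norm_le_pi_norm z j)
  calc |dirDeriv z v| ≤ ∑ i, |frameCoord z i * v i| := Finset.abs_sum_le_sum_abs _ _
    _ ≤ ∑ _i : Fin n ⊕ Fin n, ‖z‖ * ‖v‖ := by
        refine Finset.sum_le_sum fun i _ => ?_
        rw [abs_mul]
        exact mul_le_mul (h i) (PiLp.norm_apply_le v i) (abs_nonneg _) (norm_nonneg _)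
    _ = _ := by simp; ring

theorem IsWeakGradient.integral_leftField {u : Heisenberg n → ℝ}
    {g : Heisenberg n → EuclideanSpace ℝ (Fin n ⊕ Fin n)} (h : IsWeakGradient u g)
    (z : Fin n → ℂ) {φ : Heisenberg n → ℝ} (hφ : ContDiff ℝ (⊤ : ℕ∞) φ)
    (hc : HasCompactSupport φ) :
    ∫ p, u p * fderiv ℝ φ p (leftField z p) = -∫ p, dirDeriv z (g p) * φ p := by
  have hfield : ∀ i, Continuous (horizontalField (n := n) i) := by
    rintro (j | j)
    · exact continuous_mk continuous_const (continuous_const.mul (Complex.continuous_im.comp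
        ((continuous_apply j).comp continuous_fst)))
    · exact continuous_mk continuous_const (continuous_const.mul (Complex.continuous_re.comp
        ((continuous_apply j).comp continuous_fst)))
  have h1 : ∀ i, Integrable fun p => u p * fderiv ℝ φ p (horizontalField i p) := fun i => by
    have hcont : Continuous fun p => fderiv ℝ φ p (horizontalField i p) :=
      (hφ.continuous_fderiv (by simp)).clm_apply (hfield i)
    have hcs : HasCompactSupport fun p => fderiv ℝ φ p (horizontalField i p) := by
      refine (hc.fderiv ℝ).mono fun p hp => ?_
      rw [Function.mem_support] at hp ⊢
      rintro h0
      exact hp (by rw [h0]; rfl)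
    simpa [mul_comm] using
      h.locallyIntegrable.integrable_smul_left_of_hasCompactSupport hcont hcs
  have h2 : ∀ i, Integrable fun p => g p i * φ p := fun i => by
    have := h.locallyIntegrable_gradient.integrable_smul_left_of_hasCompactSupport
      hφ.continuous hc
    have := (EuclideanSpace.proj (𝕜 := ℝ) i).integrable_comp this
    simpa [mul_comm] using this
  simp_rw [leftField_eq_sum, map_sum, map_smul, dirDeriv, Finset.mul_sum, Finset.sum_mul,
    smul_eq_mul]
  rw [integral_finsetSum, integral_finsetSum, ← Finset.sum_neg_distrib]
  · refine Finset.sum_congr rfl fun i _ => ?_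
    simp_rw [mul_left_comm (u _), mul_assoc]
    rw [integral_const_mul, integral_const_mul, h.integral_eq i φ hφ hc, mul_neg]
  · intro i _
    simpa only [mul_assoc] using (h2 i).const_mul (frameCoord z i)
  · intro i _
    simpa only [mul_left_comm] using (h1 i).const_mul (frameCoord z i)

/-- The set of the points `p` for which `p · exp(-τ z)` lies in `K` for some `τ ∈ [0, 1]`. -/
def sweep (z : Fin n → ℂ) (K : Set (Heisenberg n)) : Set (Heisenberg n) :=
  (fun x : Heisenberg n × ℝ => x.1 * horizontal z x.2) '' (K ×ˢ Set.Icc 0 1)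

theorem isCompact_sweep (z : Fin n → ℂ) {K : Set (Heisenberg n)} (hK : IsCompact K) :
    IsCompact (sweep z K) :=
  (hK.prod isCompact_Icc).image
    (_root_.continuous_fst.mul ((continuous_horizontal z).comp _root_.continuous_snd))

theorem mem_sweep (z : Fin n → ℂ) {K : Set (Heisenberg n)} {p : Heisenberg n} {τ : ℝ}
    (hτ : τ ∈ Set.Icc (0 : ℝ) 1) (h : p * horizontal z (-τ) ∈ K) : p ∈ sweep z K :=
  ⟨(p * horizontal z (-τ), τ), ⟨h, hτ⟩, by
    simp [mul_assoc, horizontal_add, horizontal_zero]⟩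

/-- Lebesgue measure on `(0, 1]`. -/
abbrev unitMeasure : Measure ℝ := volume.restrict (Set.Ioc 0 1)

instance : IsProbabilityMeasure unitMeasure := ⟨by simp⟩

/-- Supplies the integrability for exchanging the integrals over the group and over `τ`. -/
theorem integrable_mul_of_support_subset {f : Heisenberg n → ℝ} (hf : LocallyIntegrable f)
    {D : Heisenberg n → ℝ → ℝ} (hD : Continuous (Function.uncurry D)) {K : Set (Heisenberg n)}
    (hK : IsCompact K) (hDK : ∀ p, ∀ τ ∈ Set.Icc (0 : ℝ) 1, p ∉ K → D p τ = 0) :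
    Integrable (fun x : Heisenberg n × ℝ => f x.1 * D x.1 x.2) (volume.prod unitMeasure) := by
  obtain ⟨C, hC⟩ := (hK.prod (isCompact_Icc (a := (0 : ℝ)) (b := 1))).exists_bound_of_continuousOn
    hD.continuousOn
  have h1 : Integrable (K.indicator f) := (hf.integrableOn_isCompact hK).integrable_indicator
    hK.measurableSet
  have h2 : Integrable (fun x : Heisenberg n × ℝ => |K.indicator f x.1| * C)
      (volume.prod unitMeasure) := h1.abs.mul_prod (integrable_const C)
  have hmeas : AEStronglyMeasurable (fun x : Heisenberg n × ℝ => f x.1)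
      (volume.prod unitMeasure) := hf.aestronglyMeasurable.comp_fst
  refine h2.mono' (hmeas.mul hD.aestronglyMeasurable) ?_
  have h3 : ∀ᵐ x : Heisenberg n × ℝ ∂(volume.prod unitMeasure), x.2 ∈ Set.Ioc (0 : ℝ) 1 :=
    Measure.quasiMeasurePreserving_snd.ae (ae_restrict_mem measurableSet_Ioc)
  filter_upwards [h3] with x hx
  have hx' : x.2 ∈ Set.Icc (0 : ℝ) 1 := Set.Ioc_subset_Icc_self hx
  by_cases hK' : x.1 ∈ K
  · rw [Set.indicator_of_mem hK', norm_mul, Real.norm_eq_abs]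
    exact mul_le_mul_of_nonneg_left (hC (x.1, x.2) ⟨hK', hx'⟩) (abs_nonneg _)
  · simp [hDK _ _ hx' hK', hK']

theorem measurePreserving_mul_horizontal (z : Fin n → ℂ) :
    MeasurePreserving (fun x : ℝ × Heisenberg n => (x.1, x.2 * horizontal z x.1))
      (unitMeasure.prod volume) (unitMeasure.prod volume) := by
  refine (MeasurePreserving.id unitMeasure).skew_product
    (g := fun (τ : ℝ) (p : Heisenberg n) => p * horizontal z τ) ?_ ?_
  · exact (_root_.continuous_snd.mul
      ((continuous_horizontal z).comp _root_.continuous_fst)).measurable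
  · exact Filter.Eventually.of_forall fun τ => map_mul_right_eq_self _ _

/-- The fundamental theorem of calculus along horizontal lines, tested against `φ`. -/
theorem IsWeakGradient.integral_sub_mul {u : Heisenberg n → ℝ}
    {g : Heisenberg n → EuclideanSpace ℝ (Fin n ⊕ Fin n)} (h : IsWeakGradient u g)
    (z : Fin n → ℂ) {φ : Heisenberg n → ℝ} (hφ : ContDiff ℝ (⊤ : ℕ∞) φ)
    (hc : HasCompactSupport φ) (hloc : LocallyIntegrable fun p => dirDeriv z (g p)) :
    ∫ p, u p * (φ (p * horizontal z (-1)) - φ p) =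
      ∫ p, (∫ τ, dirDeriv z (g (p * horizontal z τ)) ∂unitMeasure) * φ p := by
  set a : Heisenberg n → ℝ := fun p => dirDeriv z (g p) with ha
  set D : Heisenberg n → ℝ → ℝ := fun p τ =>
    fderiv ℝ φ (p * horizontal z (-τ)) (leftField z p) with hDdef
  have hmul : Continuous fun x : Heisenberg n × ℝ => x.1 * horizontal z (-x.2) :=
    _root_.continuous_fst.mul ((continuous_horizontal z).comp _root_.continuous_snd.neg)
  have hD : Continuous (Function.uncurry D) :=
    ((hφ.continuous_fderiv (by simp)).comp hmul).clm_apply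
      ((continuous_leftField z).comp _root_.continuous_fst)
  have hE : Continuous (Function.uncurry fun p τ => φ (p * horizontal z (-τ))) :=
    hφ.continuous.comp hmul
  have hK := isCompact_sweep z hc
  have hDK : ∀ p, ∀ τ ∈ Set.Icc (0 : ℝ) 1, p ∉ sweep z (tsupport φ) → D p τ = 0 := by
    intro p τ hτ hp
    have : p * horizontal z (-τ) ∉ tsupport φ := fun h => hp (mem_sweep z hτ h)
    simp only [hDdef]
    rw [fderiv_of_notMem_tsupport ℝ this]
    rfl
  have hEK : ∀ p, ∀ τ ∈ Set.Icc (0 : ℝ) 1, p ∉ sweep z (tsupport φ) →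
      φ (p * horizontal z (-τ)) = 0 := fun p τ hτ hp =>
    image_eq_zero_of_notMem_tsupport fun h => hp (mem_sweep z hτ h)
  have hI := integrable_mul_of_support_subset h.locallyIntegrable hD hK hDK
  have hJ := integrable_mul_of_support_subset hloc hE hK hEK
  have hftc : ∀ p, φ (p * horizontal z (-1)) - φ p = -∫ τ, D p τ ∂unitMeasure := by
    intro p
    have hd : ∀ τ : ℝ, HasDerivAt (fun s => φ (p * horizontal z (-s))) (-D p τ) τ := by
      intro τ
      exact ((hasDerivAt_comp_mul_horizontal hφ p z (-τ)).comp τ (hasDerivAt_neg τ)).congr_deriv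
        (mul_neg_one _)
    have := intervalIntegral.integral_eq_sub_of_hasDerivAt (a := 0) (b := 1)
      (fun τ _ => hd τ)
      ((hD.comp (Continuous.prodMk_right p)).neg.intervalIntegrable 0 1)
    rw [intervalIntegral.integral_of_le zero_le_one, integral_neg, neg_zero, horizontal_zero,
      mul_one] at this
    exact this.symm
  -- The weak derivative is tested against the translate of `φ`, which is again a test function.
  have hslice : ∀ τ : ℝ, ∫ p, u p * D p τ = -∫ p, a p * φ (p * horizontal z (-τ)) := by
    intro τ
    refine Eq.trans ?_ (h.integral_leftField z (hφ.comp (contDiff_mul_horizontal z (-τ)))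
      (hasCompactSupport_comp_mul_right hc _))
    refine integral_congr_ae (Filter.Eventually.of_forall fun p => ?_)
    exact congrArg (u p * ·) (fderiv_comp_mul_horizontal hφ p z (-τ)).symm
  have htrans : ∀ τ : ℝ, ∫ p, a p * φ (p * horizontal z (-τ)) =
      ∫ p, a (p * horizontal z τ) * φ p := by
    intro τ
    rw [← integral_mul_right_eq_self _ (horizontal z τ)]
    simp [mul_assoc, horizontal_add, horizontal_zero]
  have hJ' : Integrable (fun x : ℝ × Heisenberg n => a (x.2 * horizontal z x.1) * φ x.2)
      (unitMeasure.prod volume) := by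
    have := (measurePreserving_mul_horizontal z).integrable_comp_of_integrable hJ.swap
    refine this.congr (Filter.Eventually.of_forall fun x => ?_)
    simp [mul_assoc, horizontal_add, horizontal_zero]
  calc ∫ p, u p * (φ (p * horizontal z (-1)) - φ p)
      = -∫ p, ∫ τ, u p * D p τ ∂unitMeasure := by
        simp_rw [hftc, mul_neg, integral_const_mul, integral_neg]
    _ = -∫ τ, ∫ p, u p * D p τ ∂volume ∂unitMeasure := by
        rw [integral_integral_swap hI]
    _ = ∫ τ, ∫ p, a (p * horizontal z τ) * φ p ∂volume ∂unitMeasure := by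
        simp_rw [hslice, integral_neg, neg_neg, htrans]
    _ = ∫ p, ∫ τ, a (p * horizontal z τ) * φ p ∂unitMeasure := integral_integral_swap hJ'
    _ = _ := by simp_rw [integral_mul_const]; rfl

theorem _root_.SqrtBound.comp_mul_right {E : Type*} [NormedAddCommGroup E] {f : Heisenberg n → E}
    {N : ℝ≥0} (hf : SqrtBound f N volume) (q : Heisenberg n) :
    SqrtBound (fun p => f (p * q)) N volume :=
  hf.comp_measurePreserving (T := (Homeomorph.mulRight q).toMeasurableEquiv)
    (measurePreserving_mul_right volume q)

/-- Horizontal translations move `u` by at most the length of the translation times `|∇u|`, in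
the norm of `L^{2,∞}`. -/
theorem IsWeakGradient.sqrtBound_sub_horizontal {u : Heisenberg n → ℝ}
    {g : Heisenberg n → EuclideanSpace ℝ (Fin n ⊕ Fin n)} (h : IsWeakGradient u g)
    (hg : StronglyMeasurable g) {G : ℝ≥0} (hG : SqrtBound g G volume) (z : Fin n → ℂ) :
    SqrtBound (fun p => u (p * horizontal z 1) - u p) (2 * n * ‖z‖₊ * G) volume := by
  have ha : StronglyMeasurable fun p => dirDeriv z (g p) :=
    (continuous_dirDeriv z).comp_stronglyMeasurable hg
  have hb : SqrtBound (fun p => dirDeriv z (g p)) (2 * n * ‖z‖₊ * G) volume := by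
    intro s hs
    calc ∫⁻ p in s, ‖dirDeriv z (g p)‖ₑ ≤ ∫⁻ p in s, (2 * n * ‖z‖₊ : ℝ≥0) * ‖g p‖ₑ := by
          refine lintegral_mono fun p => ?_
          rw [enorm_eq_nnnorm, enorm_eq_nnnorm, ← ENNReal.coe_mul, ENNReal.coe_le_coe]
          exact abs_dirDeriv_le z (g p)
      _ = (2 * n * ‖z‖₊ : ℝ≥0) * ∫⁻ p in s, ‖g p‖ₑ := lintegral_const_mul _ hg.enorm
      _ ≤ (2 * n * ‖z‖₊ : ℝ≥0) * (G * volume s ^ (1 / 2 : ℝ)) := by gcongr; exact hG s hs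
      _ = _ := by rw [ENNReal.coe_mul _ G]; exact (mul_assoc _ _ _).symm
  have hmul : Continuous fun x : Heisenberg n × ℝ => x.1 * horizontal z x.2 :=
    _root_.continuous_fst.mul ((continuous_horizontal z).comp _root_.continuous_snd)
  have hFm : StronglyMeasurable (Function.uncurry fun (p : Heisenberg n) (τ : ℝ) =>
      dirDeriv z (g (p * horizontal z τ))) := ha.comp_measurable hmul.measurable
  have hF : SqrtBound (fun p => ∫ τ, dirDeriv z (g (p * horizontal z τ)) ∂unitMeasure)
      (2 * n * ‖z‖₊ * G) volume :=
    SqrtBound.integral hFm (Filter.Eventually.of_forall fun τ => hb.comp_mul_right _)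
  have hFl := hF.locallyIntegrable hFm.integral_prod_right.aestronglyMeasurable
  have hul : LocallyIntegrable fun p => u (p * horizontal z 1) := by
    refine (locallyIntegrable_map_homeomorph (Homeomorph.mulRight (horizontal z 1))).1 ?_
    rw [show Measure.map (Homeomorph.mulRight (horizontal z 1)) volume = volume from
      map_mul_right_eq_self _ _]
    exact h.locallyIntegrable
  refine hF.congr_ae ?_
  -- The tested identity becomes an almost everywhere identity: a locally integrable function
  -- orthogonal to all test functions vanishes.
  have hzero := ae_eq_zero_of_integral_contDiff_smul_eq_zero
    ((hul.sub h.locallyIntegrable).sub hFl) (fun φ hφ hc => ?_)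
  · filter_upwards [hzero] with p hp
    exact (sub_eq_zero.1 hp).symm
  · have i1 := hul.integrable_smul_left_of_hasCompactSupport hφ.continuous hc
    have i2 := h.locallyIntegrable.integrable_smul_left_of_hasCompactSupport hφ.continuous hc
    have i3 := hFl.integrable_smul_left_of_hasCompactSupport hφ.continuous hc
    have i4 := h.locallyIntegrable.integrable_smul_left_of_hasCompactSupport
      (hφ.comp (contDiff_mul_horizontal z (-1))).continuous
      (hasCompactSupport_comp_mul_right hc (horizontal z (-1)))
    have hsub := h.integral_sub_mul z hφ hc (hb.locallyIntegrable ha.aestronglyMeasurable)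
    have htrans : ∫ p, u (p * horizontal z 1) * φ p = ∫ p, u p * φ (p * horizontal z (-1)) := by
      rw [← integral_mul_right_eq_self (fun p => u p * φ (p * horizontal z (-1)))
        (horizontal z 1)]
      simp [mul_assoc, horizontal_add, horizontal_zero]
    simp only [Pi.sub_apply, smul_sub]
    rw [integral_sub (by exact i1.sub i2) i3, integral_sub i1 i2]
    simp only [smul_eq_mul, mul_comm (φ _)]
    rw [htrans, ← hsub, ← integral_sub, sub_eq_zero]
    · simp_rw [mul_sub]
    · simpa only [smul_eq_mul, mul_comm, Function.comp_def] using i4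
    · simpa only [smul_eq_mul, mul_comm] using i2

/-- Telescoping through `u (p * q)`: the cost of a translation is subadditive because right
translations preserve the measure. -/
theorem _root_.SqrtBound.sub_translate_mul {u : Heisenberg n → ℝ} (hu : StronglyMeasurable u)
    {q q' : Heisenberg n} {N N' : ℝ≥0} (h : SqrtBound (fun p => u (p * q) - u p) N volume)
    (h' : SqrtBound (fun p => u (p * q') - u p) N' volume) :
    SqrtBound (fun p => u (p * (q * q')) - u p) (N + N') volume := by
  have hm : StronglyMeasurable fun p => u (p * q) - u p :=
    (hu.comp_measurable (continuous_mul_const q).measurable).sub hu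
  convert h.add (h'.comp_mul_right q) hm.aestronglyMeasurable using 2 with p
  simp [mul_assoc]

/-- Non-commutativity makes the vertical direction reachable by horizontal moves, at a cost of the
order of the square root of the height. -/
theorem horizontal_commutator (j : Fin n) (a b : ℝ) :
    horizontal (Pi.single j (a : ℂ)) 1 * (horizontal (Pi.single j (b * Complex.I)) 1 *
      (horizontal (Pi.single j (-a : ℂ)) 1 * horizontal (Pi.single j (-b * Complex.I)) 1)) =
      mk 0 (-4 * (a * b)) := by
  have hs : ∀ (c : Fin n → ℂ) (x : ℂ), (∑ i, (Pi.single j x : Fin n → ℂ) i * c i) = x * c j := by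
    intro c x
    rw [Finset.sum_eq_single j]
    · simp
    · intro i _ hi; simp [hi]
    · simp
  have h1 : ∀ (x : ℂ) (q : Heisenberg n), (horizontal (Pi.single j x) 1 * q).2 =
      q.2 + 2 * (x * starRingEnd ℂ (q.1 j)).im := by
    intro x q
    rw [mul_snd]
    simp only [horizontal, mk, one_smul, zero_add]
    rw [hs fun i => starRingEnd ℂ (q.1 i)]
  have h2 : ∀ (x : ℂ) (i : Fin n), (horizontal (Pi.single j x) 1).1 i =
      (Pi.single j x : Fin n → ℂ) i := by
    intro x i; simp [horizontal, mk]
  refine Heisenberg.ext (fun i => ?_) ?_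
  · simp only [mul_fst, h2]
    rcases eq_or_ne i j with rfl | hi
    · simp [mk]
    · simp [hi, mk]
  · simp only [h1, mul_fst, h2, Pi.single_eq_same]
    simp [horizontal, mk]
    ring

theorem horizontal_mul_vertical (z : Fin n → ℂ) (t : ℝ) : horizontal z 1 * mk 0 t = mk z t := by
  refine Heisenberg.ext (fun i => ?_) ?_
  · rw [mul_fst]; simp [horizontal, mk]
  · rw [mul_snd]; simp [horizontal, mk]

/-- Right translations by elements of the box of radius `r` move `u` by at most a multiple of
`r |∇u|`, in the norm of `L^{2,∞}`. -/
theorem IsWeakGradient.sqrtBound_sub_translate {u : Heisenberg n → ℝ}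
    {g : Heisenberg n → EuclideanSpace ℝ (Fin n ⊕ Fin n)} (h : IsWeakGradient u g) (hn : 1 ≤ n)
    (hu : StronglyMeasurable u) (hg : StronglyMeasurable g) {G : ℝ≥0}
    (hG : SqrtBound g G volume) {r : ℝ≥0} {q : Heisenberg n} (hq : q ∈ box n r) :
    SqrtBound (fun p => u (p * q) - u p) (6 * n * r * G) volume := by
  obtain ⟨hq1, hq2⟩ := hq
  set j : Fin n := ⟨0, hn⟩
  -- Both have modulus `√|q.2| / 2`; the sign of `a` is chosen to match that of `q.2`.
  obtain ⟨a, b, ha, hb, hab⟩ : ∃ a b : ℝ, |a| ≤ r / 2 ∧ |b| ≤ r / 2 ∧ -4 * (a * b) = q.2 := by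
    have hs := Real.sqrt_nonneg |q.2|
    have hsr : Real.sqrt |q.2| ≤ r := by
      rw [← Real.sqrt_sq r.coe_nonneg]
      exact Real.sqrt_le_sqrt hq2
    have hsq : Real.sqrt |q.2| * Real.sqrt |q.2| = |q.2| := Real.mul_self_sqrt (abs_nonneg _)
    have hhalf : |Real.sqrt |q.2| / 2| ≤ r / 2 := by
      rw [abs_of_nonneg (by positivity)]; linarith
    rcases le_total 0 q.2 with h0 | h0
    · refine ⟨-(Real.sqrt |q.2| / 2), Real.sqrt |q.2| / 2, by rwa [abs_neg], hhalf, ?_⟩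
      rw [abs_of_nonneg h0] at hsq ⊢
      linarith
    · refine ⟨Real.sqrt |q.2| / 2, Real.sqrt |q.2| / 2, hhalf, hhalf, ?_⟩
      rw [abs_of_nonpos h0] at hsq ⊢
      linarith
  have key := fun z => h.sqrtBound_sub_horizontal hg hG z
  have hdec : q = horizontal q.1 1 * (horizontal (Pi.single j (a : ℂ)) 1 *
      (horizontal (Pi.single j (b * Complex.I)) 1 * (horizontal (Pi.single j (-a : ℂ)) 1 *
        horizontal (Pi.single j (-b * Complex.I)) 1))) := by
    rw [horizontal_commutator, hab, horizontal_mul_vertical]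
    rfl
  have hsum := (key q.1).sub_translate_mul hu ((key (Pi.single j (a : ℂ))).sub_translate_mul hu
    ((key (Pi.single j (b * Complex.I))).sub_translate_mul hu
      ((key (Pi.single j (-a : ℂ))).sub_translate_mul hu (key (Pi.single j (-b * Complex.I))))))
  rw [← hdec] at hsum
  -- One step of length at most `r` and four of length at most `r / 2`: total `3 r`, times `2 n G`.
  refine hsum.mono (Filter.Eventually.of_forall fun _ => le_rfl) ?_
  rw [← NNReal.coe_le_coe]
  simp only [NNReal.coe_add, NNReal.coe_mul, NNReal.coe_natCast, coe_nnnorm,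
    Pi.norm_single, norm_neg, norm_mul, Complex.norm_real, Complex.norm_I, Real.norm_eq_abs,
    mul_one, NNReal.coe_ofNat]
  have hc : (0 : ℝ) ≤ 2 * n * G := by positivity
  nlinarith [mul_le_mul_of_nonneg_left hq1 hc, mul_le_mul_of_nonneg_left ha hc,
    mul_le_mul_of_nonneg_left hb hc]

/-! ### Averages over boxes. -/

/-- The uniform probability measure on the box of radius `r`. -/
def boxMeasure (n : ℕ) (r : ℝ≥0) : Measure (Heisenberg n) :=
  ProbabilityTheory.cond volume (box n r)

/-- The average of `f` over the left translate by `p` of the box of radius `r`. -/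
def boxAverage (f : Heisenberg n → ℝ) (r : ℝ≥0) (p : Heisenberg n) : ℝ :=
  ∫ q, f (p * q) ∂boxMeasure n r

/-- `κ` is the constant for which the box of radius `r` has the volume `(κ r^{n+1})²`. -/
def IsBoxConstant (n : ℕ) (κ : ℝ≥0) : Prop :=
  0 < κ ∧ ∀ r : ℝ≥0, volume (box n r) = ((κ * r ^ (n + 1) : ℝ≥0) : ℝ≥0∞) ^ 2

theorem isProbabilityMeasure_boxMeasure {κ : ℝ≥0} (hκ : IsBoxConstant n κ) {r : ℝ≥0}
    (hr : 0 < r) : IsProbabilityMeasure (boxMeasure n r) := by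
  have := hκ.1
  have h0 : κ * r ^ (n + 1) ≠ 0 := by positivity
  refine ProbabilityTheory.cond_isProbabilityMeasure_of_finite ?_ ?_
  · rw [hκ.2]
    simpa using h0
  · rw [hκ.2]
    exact ENNReal.pow_ne_top ENNReal.coe_ne_top

theorem lintegral_boxMeasure_le {κ : ℝ≥0} (hκ : IsBoxConstant n κ) {r : ℝ≥0} (hr : 0 < r)
    {f : Heisenberg n → ℝ} {N : ℝ≥0} (hf : SqrtBound f N volume) (p : Heisenberg n) :
    ∫⁻ q, ‖f (p * q)‖ₑ ∂boxMeasure n r ≤ (N / (κ * r ^ (n + 1)) : ℝ≥0) := by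
  have hκ0 := hκ.1
  have h0 : κ * r ^ (n + 1) ≠ 0 := by positivity
  have hf' : SqrtBound (fun q => f (p * q)) N volume :=
    hf.comp_measurePreserving (T := (Homeomorph.mulLeft p).toMeasurableEquiv)
      (measurePreserving_mul_left volume p)
  have hsq : (((κ * r ^ (n + 1) : ℝ≥0) : ℝ≥0∞) ^ 2) ^ (1 / 2 : ℝ) = (κ * r ^ (n + 1) : ℝ≥0) := by
    rw [← ENNReal.rpow_natCast, ← ENNReal.rpow_mul]; norm_num
  rw [boxMeasure, ProbabilityTheory.cond, lintegral_smul_measure]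
  refine (mul_le_mul_right (hf' _ (measurableSet_box r)) _).trans_eq ?_
  rw [hκ.2, hsq, ← ENNReal.coe_pow, ← ENNReal.coe_inv (pow_ne_zero 2 h0)]
  norm_cast
  field_simp

/-- Shaped for the dyadic induction, where `w` is `u` minus its average at radius `2 r` and `c`
bounds that average. -/
theorem nnnorm_boxAverage_le {κ : ℝ≥0} (hκ : IsBoxConstant n κ) {r : ℝ≥0} (hr : 0 < r)
    {f w : Heisenberg n → ℝ} {N c : ℝ≥0} (hw : SqrtBound w N volume)
    (hfw : ∀ p, ‖f p‖₊ ≤ ‖w p‖₊ + c) (p : Heisenberg n) :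
    ‖boxAverage f r p‖₊ ≤ N / (κ * r ^ (n + 1)) + c := by
  have := isProbabilityMeasure_boxMeasure hκ hr
  rw [← ENNReal.coe_le_coe]
  calc (‖boxAverage f r p‖₊ : ℝ≥0∞) ≤ ∫⁻ q, ‖f (p * q)‖ₑ ∂boxMeasure n r :=
        enorm_integral_le_lintegral_enorm _
    _ ≤ ∫⁻ q, (‖w (p * q)‖ₑ + c) ∂boxMeasure n r := by
        refine lintegral_mono fun q => ?_
        rw [enorm_eq_nnnorm, enorm_eq_nnnorm]
        exact ENNReal.coe_le_coe.2 (hfw (p * q))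
    _ = (∫⁻ q, ‖w (p * q)‖ₑ ∂boxMeasure n r) + c := by
        rw [lintegral_add_right _ measurable_const, lintegral_const, measure_univ, mul_one]
    _ ≤ _ := by
        rw [ENNReal.coe_add]
        gcongr
        exact lintegral_boxMeasure_le hκ hr hw p

/-- The difference is an average of `u p - u (p * q)` over the box, so the translation bound
survives by Minkowski. `N` only ensures integrability and does not enter the estimate. -/
theorem IsWeakGradient.sqrtBound_sub_boxAverage {u : Heisenberg n → ℝ}
    {g : Heisenberg n → EuclideanSpace ℝ (Fin n ⊕ Fin n)} (h : IsWeakGradient u g) (hn : 1 ≤ n)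
    (hu : StronglyMeasurable u) (hg : StronglyMeasurable g) {G N κ : ℝ≥0}
    (hG : SqrtBound g G volume) (hN : SqrtBound u N volume) (hκ : IsBoxConstant n κ)
    {r : ℝ≥0} (hr : 0 < r) :
    SqrtBound (fun p => u p - boxAverage u r p) (6 * n * r * G) volume := by
  have := isProbabilityMeasure_boxMeasure hκ hr
  have hint : ∀ p, Integrable (fun q => u (p * q)) (boxMeasure n r) := fun p =>
    ⟨(hu.comp_measurable (continuous_const_mul p).measurable).aestronglyMeasurable,
      (lintegral_boxMeasure_le hκ hr hN p).trans_lt ENNReal.coe_lt_top⟩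
  have heq : ∀ p, u p - boxAverage u r p = ∫ q, (u p - u (p * q)) ∂boxMeasure n r := fun p => by
    rw [integral_sub (integrable_const _) (hint p)]
    simp [boxAverage]
  simp_rw [heq]
  refine SqrtBound.integral ?_ ?_
  · exact (hu.comp_measurable measurable_fst).sub (hu.comp_measurable continuous_mul.measurable)
  · have hmem : ∀ᵐ q ∂boxMeasure n r, q ∈ box n r :=
      ProbabilityTheory.ae_cond_mem (measurableSet_box r)
    filter_upwards [hmem] with q hq
    refine (h.sqrtBound_sub_translate hn hu hg hG hq).mono
      (Filter.Eventually.of_forall fun p => ?_) le_rfl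
    rw [← enorm_neg, neg_sub]

theorem IsWeakGradient.nnnorm_boxAverage_le {u : Heisenberg n → ℝ}
    {g : Heisenberg n → EuclideanSpace ℝ (Fin n ⊕ Fin n)} (h : IsWeakGradient u g) (hn : 1 ≤ n)
    (hu : StronglyMeasurable u) (hg : StronglyMeasurable g) {G N κ : ℝ≥0}
    (hG : SqrtBound g G volume) (hN : SqrtBound u N volume) (hκ : IsBoxConstant n κ)
    {r : ℝ≥0} (hr : 0 < r) (p : Heisenberg n) :
    ‖boxAverage u r p‖₊ ≤ 24 * n * G / κ / r ^ n := by
  have hκ0 := hκ.1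
  -- After `k` doublings of the radius, what remains is the crude bound by `N` at radius `2^k r`.
  -- The main term is reproduced since `12 + 24 / 2^n ≤ 24`, which needs `n ≥ 1`.
  have claim : ∀ (k : ℕ) (r : ℝ≥0), 0 < r → ∀ p,
      ‖boxAverage u r p‖₊ ≤ 24 * n * G / κ / r ^ n + N / (κ * (2 ^ k * r) ^ (n + 1)) := by
    intro k
    induction k with
    | zero =>
      intro r hr p
      refine (Heisenberg.nnnorm_boxAverage_le hκ hr hN (c := 0) (fun p => by simp) p).trans ?_
      rw [add_zero, pow_zero, one_mul]
      exact le_add_self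
    | succ k ih =>
      intro r hr p
      have h2r : 0 < 2 * r := by positivity
      have hw := h.sqrtBound_sub_boxAverage hn hu hg hG hN hκ h2r
      refine (Heisenberg.nnnorm_boxAverage_le hκ hr hw
        (c := 24 * n * G / κ / (2 * r) ^ n + N / (κ * (2 ^ k * (2 * r)) ^ (n + 1)))
        (fun p => ?_) p).trans ?_
      · calc ‖u p‖₊ = ‖(u p - boxAverage u (2 * r) p) + boxAverage u (2 * r) p‖₊ := by
              rw [sub_add_cancel]
          _ ≤ _ := (nnnorm_add_le _ _).trans (add_le_add_right (ih _ h2r p) _)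
      · rw [← add_assoc, pow_succ 2 k, mul_assoc (2 ^ k) 2 r]
        refine add_le_add_left ?_ _
        have e1 : 6 * n * (2 * r) * G / (κ * r ^ (n + 1)) = 12 * n * G / κ / r ^ n := by
          field_simp
          ring
        have h2n : (2 : ℝ≥0) ≤ 2 ^ n := by
          calc (2 : ℝ≥0) = 2 ^ 1 := (pow_one 2).symm
            _ ≤ 2 ^ n := pow_le_pow_right₀ one_le_two hn
        have e2 : 24 * n * G / κ / (2 * r) ^ n ≤ 12 * n * G / κ / r ^ n := by
          calc 24 * n * G / κ / (2 * r) ^ n ≤ 24 * n * G / κ / (2 * r ^ n) := by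
                rw [mul_pow]; gcongr
            _ = 12 * n * G / κ / r ^ n := by field_simp; ring
        calc _ ≤ 12 * n * G / κ / r ^ n + 12 * n * G / κ / r ^ n := add_le_add e1.le e2
          _ = _ := by ring
  -- The remainder decays, so `N` disappears; membership of `u` in `L^{2,∞}` is used only
  -- qualitatively here.
  have hlim : Filter.Tendsto (fun k : ℕ => 24 * n * G / κ / r ^ n +
      N / (κ * (2 ^ k * r) ^ (n + 1))) Filter.atTop (nhds (24 * n * G / κ / r ^ n + 0)) := by
    refine tendsto_const_nhds.add ?_
    have hp : Filter.Tendsto (fun k : ℕ => ((1 / 2 : ℝ≥0) ^ (n + 1)) ^ k) Filter.atTop (nhds 0) :=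
      NNReal.tendsto_pow_atTop_nhds_zero_of_lt_one (pow_lt_one₀ (by positivity)
        (NNReal.half_lt_self one_ne_zero) (Nat.succ_ne_zero n))
    have hp' := hp.const_mul (N / (κ * r ^ (n + 1)))
    rw [mul_zero] at hp'
    refine hp'.congr fun k => ?_
    rw [← pow_mul, mul_comm (n + 1) k, pow_mul, mul_pow, one_div, inv_pow, inv_pow]
    field_simp
  rw [add_zero] at hlim
  exact ge_of_tendsto hlim (Filter.Eventually.of_forall fun k => claim k r hr p)

/-! ### Level sets and the weak-type inequality. -/

theorem IsWeakGradient.congr_ae {u u' : Heisenberg n → ℝ}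
    {g g' : Heisenberg n → EuclideanSpace ℝ (Fin n ⊕ Fin n)} (h : IsWeakGradient u g)
    (hu : u =ᵐ[volume] u') (hg : g =ᵐ[volume] g') : IsWeakGradient u' g' where
  locallyIntegrable := h.locallyIntegrable.congr hu
  locallyIntegrable_gradient := h.locallyIntegrable_gradient.congr hg
  integral_eq i φ hφ hc := by
    rw [integral_congr_ae (g := fun p => u p * fderiv ℝ φ p (horizontalField i p))
        (hu.symm.mono fun p hp => by simp only [hp]),
      integral_congr_ae (f := fun p => g' p i * φ p) (g := fun p => g p i * φ p)
        (hg.symm.mono fun p hp => by simp only [hp])]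
    exact h.integral_eq i φ hφ hc

/-- Where `|u| > s` and the average is at most `s / 2`, the difference is at least `s / 2`;
integrate this over the level set. -/
theorem IsWeakGradient.mul_measure_le {u : Heisenberg n → ℝ}
    {g : Heisenberg n → EuclideanSpace ℝ (Fin n ⊕ Fin n)} (h : IsWeakGradient u g) (hn : 1 ≤ n)
    (hu : StronglyMeasurable u) (hg : StronglyMeasurable g) {G N κ : ℝ≥0}
    (hG : SqrtBound g G volume) (hN : SqrtBound u N volume) (hκ : IsBoxConstant n κ)
    {r s : ℝ≥0} (hr : 0 < r) (hrs : 24 * n * G / κ / r ^ n ≤ s / 2) :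
    (s / 2 : ℝ≥0) * volume {p | s < ‖u p‖₊} ≤
      (6 * n * r * G : ℝ≥0) * volume {p | s < ‖u p‖₊} ^ (1 / 2 : ℝ) := by
  have hmeas : MeasurableSet {p | s < ‖u p‖₊} :=
    measurableSet_lt measurable_const hu.measurable.nnnorm
  refine le_trans ?_ (h.sqrtBound_sub_boxAverage hn hu hg hG hN hκ hr _ hmeas)
  rw [← setLIntegral_const]
  refine setLIntegral_mono' hmeas fun p hp => ?_
  rw [enorm_eq_nnnorm, ENNReal.coe_le_coe]
  have h1 : ‖boxAverage u r p‖₊ ≤ s / 2 :=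
    (h.nnnorm_boxAverage_le hn hu hg hG hN hκ hr p).trans hrs
  have h2 : ‖u p‖₊ ≤ ‖u p - boxAverage u r p‖₊ + ‖boxAverage u r p‖₊ := by
    simpa using nnnorm_add_le (u p - boxAverage u r p) (boxAverage u r p)
  have h3 : s / 2 + s / 2 ≤ ‖u p - boxAverage u r p‖₊ + s / 2 := by
    rw [add_halves]
    exact (le_of_lt hp).trans (h2.trans (add_le_add_right h1 _))
  exact le_of_add_le_add_right h3

theorem IsWeakGradient.mul_measure_rpow_le {u : Heisenberg n → ℝ}
    {g : Heisenberg n → EuclideanSpace ℝ (Fin n ⊕ Fin n)} (h : IsWeakGradient u g) (hn : 1 ≤ n)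
    (hu : StronglyMeasurable u) (hg : StronglyMeasurable g) {G N κ : ℝ≥0} (hG0 : 0 < G)
    (hG : SqrtBound g G volume) (hN : SqrtBound u N volume) (hκ : IsBoxConstant n κ)
    {s : ℝ≥0} (hs : 0 < s) (hfin : volume {p | s < ‖u p‖₊} ≠ ∞) :
    (s : ℝ≥0∞) * volume {p | s < ‖u p‖₊} ^ ((n : ℝ) / (2 * (n + 1))) ≤
      (12 * n * (4 / κ) ^ (1 / (n + 1) : ℝ) * G : ℝ≥0) := by
  have hκ0 := hκ.1
  have hn0 : n ≠ 0 := by omega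
  have hnpos : (0 : ℝ≥0) < n := by positivity
  set x : ℝ≥0 := NNReal.sqrt (volume {p | s < ‖u p‖₊}).toNNReal with hx
  have hxs : volume {p | s < ‖u p‖₊} = (x : ℝ≥0∞) ^ (2 : ℝ) := by
    rw [ENNReal.rpow_two, ← ENNReal.coe_pow, hx, NNReal.sq_sqrt, ENNReal.coe_toNNReal hfin]
  -- The radius at which the sup bound on the average equals exactly `s / 2`.
  set r : ℝ≥0 := (48 * n * G / κ / s) ^ ((n : ℝ)⁻¹) with hr
  have hrn : r ^ n = 48 * n * G / κ / s := NNReal.rpow_inv_natCast_pow _ hn0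
  have hr0 : 0 < r := NNReal.rpow_pos (by positivity)
  have hmain := h.mul_measure_le hn hu hg hG hN hκ hr0 (s := s) (by
    rw [hrn]
    refine le_of_eq ?_
    field_simp
    norm_num)
  rw [hxs, ← ENNReal.rpow_mul, mul_one_div_cancel two_ne_zero, ENNReal.rpow_one,
    ENNReal.rpow_two, ← ENNReal.coe_pow, ← ENNReal.coe_mul, ← ENNReal.coe_mul,
    ENNReal.coe_le_coe] at hmain
  have hsx : s * x ≤ 12 * n * r * G := by
    have h1 : s / 2 * x ^ 2 ≤ 6 * n * r * G * x := hmain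
    rcases eq_or_ne x 0 with h0 | h0
    · rw [h0, mul_zero]; exact zero_le
    · have hx0 : 0 < x := pos_iff_ne_zero.2 h0
      have h2 : s / 2 * x * x ≤ 6 * n * r * G * x := by rwa [mul_assoc, ← sq]
      have h3 := le_of_mul_le_mul_right h2 hx0
      calc s * x = 2 * (s / 2 * x) := by field_simp
        _ ≤ 2 * (6 * n * r * G) := by gcongr
        _ = 12 * n * r * G := by ring
  -- Taking `n`-th powers of `hsx` makes `r` appear as `r ^ n`, and the spare factor `s` cancels the
  -- one in its denominator.
  have hpow : s ^ (n + 1) * x ^ n ≤ 4 / κ * (12 * n * G) ^ (n + 1) := by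
    calc s ^ (n + 1) * x ^ n = s * (s * x) ^ n := by ring
      _ ≤ s * (12 * n * r * G) ^ n := by gcongr
      _ = s * (r ^ n * (12 * n * G) ^ n) := by ring
      _ = 4 / κ * (12 * n * G) ^ (n + 1) := by
          rw [hrn]
          field_simp
          ring
  rw [hxs, ← ENNReal.rpow_mul, ← ENNReal.coe_rpow_of_nonneg _ (by positivity),
    ← ENNReal.coe_mul, ENNReal.coe_le_coe, ← pow_le_pow_iff_left₀ zero_le zero_le
      (Nat.succ_ne_zero n)]
  have hn1 : (n : ℝ) + 1 ≠ 0 := by positivity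
  calc (s * x ^ (2 * ((n : ℝ) / (2 * (n + 1))))) ^ (n + 1) = s ^ (n + 1) * x ^ n := by
        rw [mul_pow, ← NNReal.rpow_natCast (x ^ _), ← NNReal.rpow_mul, ← NNReal.rpow_natCast x n]
        congr 2
        push_cast
        field_simp
    _ ≤ 4 / κ * (12 * n * G) ^ (n + 1) := hpow
    _ = _ := by
        have : ((4 / κ) ^ (1 / (n + 1) : ℝ)) ^ (n + 1) = 4 / κ := by
          rw [← NNReal.rpow_natCast, ← NNReal.rpow_mul]
          push_cast
          rw [one_div_mul_cancel hn1, NNReal.rpow_one]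
        rw [Nat.succ_eq_add_one, mul_right_comm (12 * (n : ℝ≥0)),
          mul_pow (12 * (n : ℝ≥0) * G), this, mul_comm]

end Heisenberg
end

theorem mainTheorem5 (n : ℕ) (hn : 1 ≤ n) :
    ∃ C : ℝ≥0, ∀ (u : Heisenberg n → ℝ)
      (g : Heisenberg n → EuclideanSpace ℝ (Fin n ⊕ Fin n)),
      MemWeakLp u 2 volume → Heisenberg.IsWeakGradient u g → MemWeakLp g 2 volume →
        weakLpNorm u (2 * (Heisenberg.homDim n : ℝ) / ((Heisenberg.homDim n : ℝ) - 2)) volume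
          ≤ (C : ℝ≥0∞) * weakLpNorm g 2 volume := by
  obtain ⟨κ, hκ⟩ := Heisenberg.exists_volume_box n
  have hκ0 := hκ.1
  have hn0 : (0 : ℝ≥0) < n := by exact_mod_cast hn
  set C : ℝ≥0 := 12 * n * (4 / κ) ^ (1 / (n + 1) : ℝ) with hC
  have hC0 : 0 < C := mul_pos (by positivity) (NNReal.rpow_pos (by positivity))
  refine ⟨C * 2, fun u g hu h hg => ?_⟩
  -- Strongly measurable representatives: hypotheses and conclusion depend only on almost everywhere
  -- classes.
  set u' := hu.1.mk u
  set g' := hg.1.mk g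
  have hu' : StronglyMeasurable u' := hu.1.stronglyMeasurable_mk
  have hg' : StronglyMeasurable g' := hg.1.stronglyMeasurable_mk
  have h' : Heisenberg.IsWeakGradient u' g' := h.congr_ae hu.1.ae_eq_mk hg.1.ae_eq_mk
  rw [weakLpNorm_congr_ae hu.1.ae_eq_mk, weakLpNorm_congr_ae hg.1.ae_eq_mk]
  have hu2 : weakLpNorm u' 2 volume < ∞ := weakLpNorm_congr_ae hu.1.ae_eq_mk 2 ▸ hu.2
  have hg2 : weakLpNorm g' 2 volume < ∞ := weakLpNorm_congr_ae hg.1.ae_eq_mk 2 ▸ hg.2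
  obtain ⟨U, hU⟩ := ENNReal.lt_iff_exists_coe.1 hu2
  obtain ⟨W, hW⟩ := ENNReal.lt_iff_exists_coe.1 hg2
  have hU1 : weakLpNorm u' 2 volume ≤ (U + 1 : ℝ≥0) := by
    rw [hU.1]
    exact_mod_cast le_self_add
  have hN := sqrtBound_of_weakLpNorm_le hu'.aestronglyMeasurable (by positivity) hU1
  have hexp : 1 / (2 * (Heisenberg.homDim n : ℝ) / ((Heisenberg.homDim n : ℝ) - 2)) =
      (n : ℝ) / (2 * (n + 1)) := by
    have : (n : ℝ) ≠ 0 := by exact_mod_cast hn0.ne'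
    simp only [Heisenberg.homDim, Nat.cast_add, Nat.cast_mul, Nat.cast_ofNat, add_sub_cancel_right]
    field_simp
  -- The level-set estimate needs a positive gradient bound, while `W` may be zero; the increment `ε
  -- / (C * 2)` costs exactly `ε` in the end.
  refine ENNReal.le_of_forall_pos_le_add fun ε hε _ => ?_
  set V : ℝ≥0 := W + ε / (C * 2) with hV
  have hV0 : 0 < V := by positivity
  have hWV : weakLpNorm g' 2 volume ≤ V := by
    rw [hW.1]
    exact_mod_cast le_self_add
  have hG := sqrtBound_of_weakLpNorm_le hg'.aestronglyMeasurable hV0 hWV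
  have hbound : (C * (2 * V) : ℝ≥0) = C * 2 * W + ε := by
    rw [hV]
    field_simp
  rw [hW.1, ← ENNReal.coe_mul, ← ENNReal.coe_add, ← hbound]
  refine iSup₂_le fun s hs => ?_
  rw [hexp]
  exact h'.mul_measure_rpow_le hn hu' hg' (by positivity) hG hN hκ hs
    ((measure_lt_nnnorm_le hU1 hs).trans_lt ENNReal.coe_lt_top).ne
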